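/- Let $K$ be a field. For a totally ordered abelian group $\Gamma$ let $K_w[\Gamma]$ be the field of Malcev–Neumann series, i.e. formal series $\sum_{g\in\Gamma}a_g t^g$ ($a_g\in K$) with well-ordered support; a family of series strictly converges to $\eta$ if for each exponent only finitely many members have a nonzero coefficient there and these coefficients add up to that of $\eta$. Let $G$ be an abelian group, $n\ge 0$, and suppose that $G\oplus\mathbb Z^n$ is equipped with a translation-invariant total order $\le$; give $G=G\oplus 0$ the induced order. Write $x_1,\dots,x_n$ for the monomials corresponding to the standard basis $e_1,\dots,e_n$ of $\mathbb Z^n$, so that each $\eta\in K_w[G\oplus\mathbb Z^n]$ has the form $\eta=\sum_{k\in\mathbb Z^n}b_k x^k$ with $b_k\in K_w[G]$. Put $\operatorname{CT}_x\eta=b_0$, $\operatorname{Res}_x\eta=b_{(-1,\dots,-1)}$ and $\partial\eta/\partial x_i=\sum_k k_i b_k x^{k-e_i}$. The $x$-initial term of $\eta\neq 0$ is the nonzero term $b_kx^k$ of least order, where the order of a nonzero series is the least element of its support. Let $F_1,\dots,F_n\in K_w[G\oplus\mathbb Z^n]$ be such that $F_i$ has $x$-initial term $f_i=a_i x_1^{b_{i1}}\cdots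 x_n^{b_{in}}$ with $0\ne a_i\in K_w[G]$, and define $$J(F)=\det\Bigl(\frac{\partial F_i}{\partial x_j}\Bigr),\qquad LJ(F)=\frac{x_1\cdots x_n}{F_1\cdots F_n}J(F),\qquad j(F)=\det(b_{ij})\in\mathbb Z .$$ Assume that the integer $j(F)$ is nonzero. Let $\rho$ be the endomorphism of $G\oplus\mathbb Z^n$ with $\rho(g)=g$ for $g\in G$ and $\rho(e_i)=\operatorname{ord}(a_i)+\sum_j b_{ij}e_j$, the exponent of the initial monomial of $F_i$; it is injective, so that $u\le^{\rho}v\Leftrightarrow\rho(u)\le\rho(v)$ is again a translation-invariant total order on $G\oplus\mathbb Z^n$. Let $K_w^{f}[G\oplus\mathbb Z^n]$ be the field of Malcev–Neumann series with respect to $\le^{\rho}$. For $\Phi\in K_w^{f}[G\oplus\mathbb Z^n]$ write $\Phi=\sum_{k}c_kx^k$ with $c_k\in K_w[G]$, and put $\operatorname{CT}_F\Phi(F)=c_0$ and $\operatorname{Res}_F\Phi(F)=c_{(-1,\dots,-1)}$. Then for every $\Phi\in K_w^{f}[G\oplus\mathbb Z^n]$ the series $\Phi(F)=\sum_{k}c_kF_1^{k_1}\cdots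 F_n^{k_n}$ strictly converges in $K_w[G\oplus\mathbb Z^n]$, and the following identities hold in $K_w[G]$: $$\operatorname{Res}_x \Phi(F)\,J(F)=j(F)\,\operatorname{Res}_F\Phi(F),\qquad \operatorname{CT}_x \Phi(F)\,LJ(F)=j(F)\,\operatorname{CT}_F\Phi(F).$$ -/

import Mathlib

/-! # Malcev-Neumann series on `G ⊕ ℤⁿ`

For a totally ordered abelian group `Γ` and a field `K`, the field `K_w[Γ]` of Malcev-Neumann series
(formal series with well-ordered support) is Mathlib's `HahnSeries Γ K`. -/

namespace MNSeries

/-- The group `G ⊕ ℤⁿ` of exponents; the pair `(g, k)` is the exponent of `t ^ g * x ^ k`.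
It carries no order of its own: the total order is always given as an extra instance. -/
def Expo (G : Type*) (n : ℕ) : Type _ := G × (Fin n → ℤ)

/-- The subgroup `G = G ⊕ 0` of `G ⊕ ℤⁿ`, as a type of its own, so that it can carry the order
induced from `G ⊕ ℤⁿ`. -/
def Base (G : Type*) (_n : ℕ) : Type _ := G

section Groups

variable {G : Type*} {n : ℕ}

/-- The exponent of `t ^ g * x ^ k`. -/
def expo (g : Base G n) (k : Fin n → ℤ) : Expo G n := (g, k)

/-- The `G`-part of an exponent. -/
def gPart (a : Expo G n) : Base G n := a.1

/-- The exponents of `x₁, …, xₙ` in a monomial. -/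
def xPart (a : Expo G n) : Fin n → ℤ := a.2

@[ext] theorem expo_ext {a b : Expo G n} (h₁ : gPart a = gPart b) (h₂ : xPart a = xPart b) :
    a = b := Prod.ext h₁ h₂

@[simp] theorem gPart_expo (g : Base G n) (k : Fin n → ℤ) : gPart (expo g k) = g := rfl
@[simp] theorem xPart_expo (g : Base G n) (k : Fin n → ℤ) : xPart (expo g k) = k := rfl

variable [AddCommGroup G]

instance : AddCommGroup (Expo G n) := inferInstanceAs (AddCommGroup (G × (Fin n → ℤ)))

instance : AddCommGroup (Base G n) := inferInstanceAs (AddCommGroup G)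

@[simp] theorem gPart_add (a b : Expo G n) : gPart (a + b) = gPart a + gPart b := rfl
@[simp] theorem xPart_add (a b : Expo G n) : xPart (a + b) = xPart a + xPart b := rfl
@[simp] theorem gPart_zero : gPart (0 : Expo G n) = 0 := rfl
@[simp] theorem xPart_zero : xPart (0 : Expo G n) = 0 := rfl

/-- The projection `G ⊕ ℤⁿ → ℤⁿ` as a homomorphism. -/
def xPartHom : Expo G n →+ (Fin n → ℤ) where
  toFun := xPart
  map_zero' := rfl
  map_add' _ _ := rfl

theorem expo_add (g g' : Base G n) (k k' : Fin n → ℤ) :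
    expo (g + g') (k + k') = expo g k + expo g' k' := rfl

/-- The inclusion of `G` in `G ⊕ ℤⁿ`. -/
def baseHom : Base G n →+ Expo G n where
  toFun g := expo g 0
  map_zero' := rfl
  map_add' g g' := by ext <;> simp

@[simp] theorem baseHom_apply (g : Base G n) : baseHom g = expo g 0 := rfl

theorem baseHom_injective : Function.Injective (baseHom : Base G n → Expo G n) :=
  fun _ _ h => congrArg gPart h

/-- The endomorphism `ρ` of `G ⊕ ℤⁿ` with `ρ(x_i) = f_i` for all `i` and `ρ(g) = g` for all
`g ∈ G`, where `f_1, …, f_n` are (exponents of) monomials. -/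
def substHom (f : Fin n → Expo G n) : Expo G n →+ Expo G n where
  toFun a := expo (gPart a) 0 + ∑ i, xPart a i • f i
  map_zero' := by
    have h : expo (0 : Base G n) (0 : Fin n → ℤ) = 0 := rfl
    simp [h]
  map_add' a b := by
    have h : expo (gPart (a + b)) 0 = expo (gPart a) 0 + expo (gPart b) (0 : Fin n → ℤ) := by
      ext <;> simp
    simp only [h, xPart_add, Pi.add_apply, add_smul, Finset.sum_add_distrib]
    abel

theorem substHom_apply (f : Fin n → Expo G n) (a : Expo G n) :
    substHom f a = expo (gPart a) 0 + ∑ i, xPart a i • f i := rfl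

/-- The integer matrix whose `i`-th row consists of the exponents of `x₁, …, xₙ` in `f_i`. -/
def xMatrix (f : Fin n → Expo G n) : Matrix (Fin n) (Fin n) ℤ := fun i j => xPart (f i) j

theorem substHom_injective (f : Fin n → Expo G n) (hf : (xMatrix f).det ≠ 0) :
    Function.Injective (substHom f) := by
  rw [injective_iff_map_eq_zero]
  intro a ha
  have hx : xPart a = 0 := by
    apply Matrix.eq_zero_of_vecMul_eq_zero hf
    have h := congrArg xPartHom ha
    rw [substHom_apply, map_add, map_sum, map_zero] at h
    have h0 : xPartHom (expo (gPart a) 0) = 0 := rfl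
    rw [h0, zero_add] at h
    ext j
    have hj := congrFun h j
    simp only [Finset.sum_apply, map_zsmul, Pi.smul_apply, smul_eq_mul] at hj
    exact hj
  rw [substHom_apply, hx] at ha
  have hg : gPart a = 0 := by
    simpa using congrArg gPart ha
  exact expo_ext hg hx

/-- The group `G ⊕ ℤⁿ`, to be equipped with the order `≤^ρ` induced by the injective endomorphism
`ρ : x_i ↦ f_i` of the ordered group `G ⊕ ℤⁿ`. -/
def Reordered (f : Fin n → Expo G n) (_hf : (xMatrix f).det ≠ 0) : Type _ := Expo G n

instance (f : Fin n → Expo G n) (hf : (xMatrix f).det ≠ 0) : AddCommGroup (Reordered f hf) :=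
  inferInstanceAs (AddCommGroup (Expo G n))

/-- The identity map, from the re-ordered group to the original one. -/
def ofReordered {f : Fin n → Expo G n} {hf : (xMatrix f).det ≠ 0} : Reordered f hf ≃+ Expo G n :=
  AddEquiv.refl (Expo G n)

end Groups

noncomputable section

variable {G : Type*} [AddCommGroup G] {n : ℕ} [LinearOrder (Expo G n)]

/-- The order induced on `G` from `G ⊕ ℤⁿ`. -/
instance : LinearOrder (Base G n) :=
  LinearOrder.lift' (baseHom : Base G n → Expo G n) baseHom_injective

/-- The order `≤^ρ`: `a ≤^ρ b` if and only if `ρ a ≤ ρ b`. -/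
instance (f : Fin n → Expo G n) (hf : (xMatrix f).det ≠ 0) : LinearOrder (Reordered f hf) :=
  LinearOrder.lift' (fun a => substHom f (ofReordered a))
    ((substHom_injective f hf).comp ofReordered.injective)

variable [IsOrderedAddMonoid (Expo G n)]

instance : IsOrderedAddMonoid (Base G n) where
  add_le_add_left a b h c := by
    change baseHom (a + c) ≤ baseHom (b + c)
    rw [map_add, map_add]
    exact add_le_add_left (show baseHom a ≤ baseHom b from h) _

instance (f : Fin n → Expo G n) (hf : (xMatrix f).det ≠ 0) :
    IsOrderedAddMonoid (Reordered f hf) where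
  add_le_add_left a b h c := by
    change substHom f (ofReordered (a + c)) ≤ substHom f (ofReordered (b + c))
    rw [map_add, map_add, map_add, map_add]
    exact add_le_add_left
      (show substHom f (ofReordered a) ≤ substHom f (ofReordered b) from h) _

/-- `g ↦ (g, k)` as an order embedding of `G` in `G ⊕ ℤⁿ`. -/
def fiber (k : Fin n → ℤ) : Base G n ↪o Expo G n where
  toFun g := expo g k
  inj' _ _ h := congrArg gPart h
  map_rel_iff' {g g'} := by
    have h : ∀ g : Base G n, expo g k = baseHom g + expo 0 k := fun g => by
      ext <;> simp
    change expo g k ≤ expo g' k ↔ baseHom g ≤ baseHom g'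
    rw [h g, h g', add_le_add_iff_right]

/-- `g ↦ (g, k)` as an order embedding of `G` in `G ⊕ ℤⁿ` with the order `≤^ρ`. -/
def reorderedFiber (f : Fin n → Expo G n) (hf : (xMatrix f).det ≠ 0) (k : Fin n → ℤ) :
    Base G n ↪o Reordered f hf where
  toFun g := ofReordered.symm (expo g k)
  inj' _ _ h := congrArg gPart h
  map_rel_iff' {g g'} := by
    have h : ∀ g : Base G n, substHom f (expo g k) = baseHom g + ∑ i, k i • f i := fun _ => rfl
    change substHom f (expo g k) ≤ substHom f (expo g' k) ↔ baseHom g ≤ baseHom g'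
    rw [h g, h g', add_le_add_iff_right]

variable {K : Type*} [Field K]

/-- Restriction of a series along an order embedding of the exponents. -/
def restrict {Γ Γ' : Type*} [LinearOrder Γ] [LinearOrder Γ'] (φ : Γ' ↪o Γ) (η : HahnSeries Γ K) :
    HahnSeries Γ' K where
  coeff g := η.coeff (φ g)
  isPWO_support' := by
    intro s
    obtain ⟨i, j, hij, h⟩ := η.isPWO_support fun m => ⟨φ (s m).1, (s m).2⟩
    exact ⟨i, j, hij, φ.le_iff_le.1 h⟩

/-- The field `K_w[G]`. -/
abbrev BaseField (G : Type*) [AddCommGroup G] (n : ℕ) [LinearOrder (Expo G n)] (K : Type*)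
    [Field K] : Type _ := HahnSeries (Base G n) K

/-- The field `K_w[G ⊕ ℤⁿ]`. -/
abbrev MN (G : Type*) [AddCommGroup G] (n : ℕ) [LinearOrder (Expo G n)] (K : Type*)
    [Field K] : Type _ := HahnSeries (Expo G n) K

/-- The re-ordered field `K_w^f[G ⊕ ℤⁿ]`: series on `G ⊕ ℤⁿ` whose support is well-ordered for the
order induced by the endomorphism `x_i ↦ f_i`. -/
abbrev ReorderedMN (f : Fin n → Expo G n) (hf : (xMatrix f).det ≠ 0) (K : Type*)
    [Field K] : Type _ := HahnSeries (Reordered f hf) K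

/-- The coefficient `b_k ∈ K_w[G]` of `x ^ k` in `η = ∑ b_k x ^ k ∈ K_w[G ⊕ ℤⁿ]`. -/
def xCoeff (k : Fin n → ℤ) (η : MN G n K) : BaseField G n K := restrict (fiber k) η

/-- The coefficient `b_k ∈ K_w[G]` of `x ^ k` in an element of `K_w^f[G ⊕ ℤⁿ]`. -/
def reorderedXCoeff {f : Fin n → Expo G n} {hf : (xMatrix f).det ≠ 0} (k : Fin n → ℤ)
    (Φ : ReorderedMN f hf K) : BaseField G n K := restrict (reorderedFiber f hf k) Φ

/-- `CT_x`, the constant term in `x₁, …, xₙ`, in `K_w[G ⊕ ℤⁿ]`. -/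
def CT (η : MN G n K) : BaseField G n K := xCoeff 0 η

/-- `Res_x`, the coefficient of `x₁⁻¹ ⋯ xₙ⁻¹`, in `K_w[G ⊕ ℤⁿ]`. -/
def Res (η : MN G n K) : BaseField G n K := xCoeff (fun _ => -1) η

/-- The constant term in the variables, taken in the re-ordered field. -/
def reorderedCT {f : Fin n → Expo G n} {hf : (xMatrix f).det ≠ 0} (Φ : ReorderedMN f hf K) :
    BaseField G n K := reorderedXCoeff 0 Φ

/-- The residue in the variables, taken in the re-ordered field. -/
def reorderedRes {f : Fin n → Expo G n} {hf : (xMatrix f).det ≠ 0} (Φ : ReorderedMN f hf K) :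
    BaseField G n K := reorderedXCoeff (fun _ => -1) Φ

/-- The inclusion of `K_w[G]` in `K_w[G ⊕ ℤⁿ]`. -/
def ofBase : BaseField G n K →+* MN G n K :=
  HahnSeries.embDomainRingHom baseHom baseHom_injective fun _ _ => Iff.rfl

/-- The variable `x_i`. -/
def X (i : Fin n) : MN G n K := HahnSeries.single (expo 0 (Pi.single i 1)) 1

/-- `x_i ∂/∂x_i`, that is, `∑ b_k x ^ k ↦ ∑ k_i b_k x ^ k`. -/
def eulerDeriv (i : Fin n) (η : MN G n K) : MN G n K where
  coeff a := (xPart a i : K) * η.coeff a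
  isPWO_support' := η.isPWO_support.mono fun _ ha => right_ne_zero_of_mul ha

/-- `∂/∂x_i`, that is, `∑ b_k x ^ k ↦ ∑ k_i b_k x ^ (k - e_i)`. -/
def pderiv (i : Fin n) (η : MN G n K) : MN G n K :=
  HahnSeries.single (expo 0 (-Pi.single i 1)) 1 * eulerDeriv i η

/-- The Jacobian determinant `J(F₁, …, Fₙ) = det (∂F_i/∂x_j)`. -/
def jacobian (F : Fin n → MN G n K) : MN G n K :=
  Matrix.det (Matrix.of fun i j => pderiv j (F i))

/-- The log Jacobian `LJ(F₁, …, Fₙ) = (x₁ ⋯ xₙ) / (F₁ ⋯ Fₙ) * J(F₁, …, Fₙ)`. -/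
def logJacobian (F : Fin n → MN G n K) : MN G n K :=
  (∏ i, X i) / (∏ i, F i) * jacobian F

/-- `c * x ^ k` is the `x`-initial term of `η = ∑ b_l x ^ l`: it is the nonzero `x`-term of `η` of
least order. The order of a nonzero `x`-term `b_l x ^ l` is `(ord b_l, l)`. -/
def IsXInitialTerm (η : MN G n K) (c : BaseField G n K) (k : Fin n → ℤ) : Prop :=
  c ≠ 0 ∧ xCoeff k η = c ∧
    ∀ l, l ≠ k → xCoeff l η ≠ 0 → expo c.order k < expo (xCoeff l η).order l

/-- The exponent `(ord a_i, b_{i1}, …, b_{in})` of the initial monomial of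
`f_i = a_i x₁ ^ b_{i1} ⋯ xₙ ^ b_{in}`. -/
def initialExpo (a : Fin n → BaseField G n K) (b : Matrix (Fin n) (Fin n) ℤ) (i : Fin n) :
    Expo G n := expo (a i).order (b i)

/-- Strict convergence: the sum of the family `s` strictly converges to `η` if for every exponent
only finitely many members of the family have a nonzero coefficient there, and these
coefficients sum to the coefficient of `η`. -/
def StrictlyConverges {Γ : Type*} [LinearOrder Γ] {ι : Type*} (s : ι → HahnSeries Γ K)
    (η : HahnSeries Γ K) : Prop :=
  ∀ g, {i | (s i).coeff g ≠ 0}.Finite ∧ ∑ᶠ i, (s i).coeff g = η.coeff g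

/-- `Ψ = Φ(F₁, …, Fₙ)`: for `Φ = ∑ b_k x ^ k`, the series `∑ b_k F₁ ^ k₁ ⋯ Fₙ ^ kₙ` strictly
converges to `Ψ` in `K_w[G ⊕ ℤⁿ]`. -/
def IsComposition {f : Fin n → Expo G n} {hf : (xMatrix f).det ≠ 0} (Φ : ReorderedMN f hf K)
    (F : Fin n → MN G n K) (Ψ : MN G n K) : Prop :=
  StrictlyConverges (fun k : Fin n → ℤ => ofBase (reorderedXCoeff k Φ) * ∏ i, F i ^ k i) Ψ

end

end MNSeries

/-! # The residue theorem for Malcev-Neumann series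

By strict convergence `CT_x` may be taken term by term in `Φ(F) LJ(F) = ∑ c_k F ^ k LJ(F)`, and it is
linear over `K_w[G]`; so the second identity reduces to `CT_x (F ^ k LJ(F)) = j(F)` for `k = 0` and
`= 0` for `k ≠ 0` (`CT_prod_zpow_mul_logJacobian`, `xCoeff_hsum_mul`). The first identity follows
from the second computation, because `x₁ ⋯ xₙ F ^ k J(F) = F ^ (k + 1) LJ(F)`.

With the Euler derivations `θ_j = x_j ∂/∂x_j`, the series `F ^ k LJ(F)` is the determinant of the
matrix with entries `F_i ^ k_i θ_j F_i / F_i`. In characteristic zero its `i`-th row is the gradient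
of `F_i ^ k_i / k_i` if `k_i ≠ 0`; if `k_i = 0` and `F_i` is a constant times a monomial `f_i` times
`1 + ν_i`, it is the constant row `b_i` plus the gradient of `log (1 + ν_i)` (`exists_theta_log`). So
every row is a constant row plus a gradient. Replacing a row by a gradient in a matrix whose other
rows are closed gives a sum of Euler derivatives by the Piola identity
(`sum_derivation_cofactor_eq_zero`), and Euler derivatives have no constant term. Hence all gradients
may be dropped (`coeff_det_C_add_theta`), and what is left is the determinant of the constant rows.

In characteristic `p` the series `F_i ^ k_i / k_i` need not make sense. After the constants have been
split off, the `F_i` are monic, and they lift to monic, hence invertible, series over the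
polynomial ring `ℤ[K]`, which maps onto `K` and embeds in a field of characteristic zero; the
identity descends (`coeff_det_logMatrix`).

Convergence: the support of `c_k F ^ k` lies in `ρ (supp c_k x ^ k) + T`, where `T` is the
monoid generated by the supports of the `ν_i`. Both `ρ (supp Φ)` and `T` are well-ordered and `ρ`
is injective, so each exponent occurs in finitely many terms (`exists_summableFamily`).
-/

open HahnSeries Finset

namespace MNSeries

/-! ### The Euler derivations -/

section Theta

variable {G : Type*} [AddCommGroup G] {n : ℕ} [LinearOrder (Expo G n)]
  [IsOrderedAddMonoid (Expo G n)] {R : Type*} [CommRing R]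

/-- The Euler derivation `x_j ∂/∂x_j`, that is, `eulerDeriv j` for series with coefficients in any
commutative ring. -/
noncomputable def theta (j : Fin n) :
    Derivation R (HahnSeries (Expo G n) R) (HahnSeries (Expo G n) R) :=
  Derivation.mk'
    { toFun := fun η =>
        { coeff := fun a => (xPart a j : R) * η.coeff a
          isPWO_support' := η.isPWO_support.mono fun _ ha => right_ne_zero_of_mul ha }
      map_add' := fun x y => by ext a; simp [mul_add]
      map_smul' := fun r x => by ext a; simp [mul_left_comm] }
    fun x y => by
      ext a
      simp only [LinearMap.coe_mk, AddHom.coe_mk, smul_eq_mul, coeff_add]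
      have hs : ∀ (z : HahnSeries (Expo G n) R)
          (h : (Function.support fun a => (xPart a j : R) * z.coeff a).IsPWO),
          support (⟨fun a => (xPart a j : R) * z.coeff a, h⟩ : HahnSeries (Expo G n) R) ⊆
            z.support := fun z h a ha => right_ne_zero_of_mul (mem_support _ _ |>.1 ha)
      rw [coeff_mul_right' y.isPWO_support (hs y _), mul_comm y,
        coeff_mul_left' x.isPWO_support (hs x _),
        coeff_mul, Finset.mul_sum,
        ← Finset.sum_add_distrib]
      refine Finset.sum_congr rfl fun p hp => ?_
      rw [Finset.mem_antidiagonal] at hp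
      rw [← hp.2.2, xPart_add, Pi.add_apply, Int.cast_add]
      ring

@[simp] theorem theta_coeff (j : Fin n) (η : HahnSeries (Expo G n) R) (a : Expo G n) :
    (theta j η).coeff a = (xPart a j : R) * η.coeff a := rfl

theorem theta_comm (i j : Fin n) (η : HahnSeries (Expo G n) R) :
    theta i (theta j η) = theta j (theta i η) := by
  ext a; simp [mul_left_comm]

@[simp] theorem theta_C (j : Fin n) (r : R) : theta (G := G) j (C r) = 0 := by
  rw [C_eq_algebraMap]; exact Derivation.map_algebraMap _ _

theorem theta_single (j : Fin n) (e : Expo G n) (r : R) :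
    theta j (single e r) = C (xPart e j : R) * single e r := by
  ext a
  rw [C_mul_eq_smul, theta_coeff, coeff_smul, smul_eq_mul]
  by_cases h : a = e
  · rw [h]
  · simp [coeff_single_of_ne h]

end Theta

/-! ### Determinants whose rows are closed forms -/

section Det

variable {R A : Type*} [CommRing R] [CommRing A] [Algebra R A] {m : Type*} [Fintype m]
  [DecidableEq m]

/-- The Leibniz rule for determinants. -/
theorem derivation_det (D : Derivation R A A) (M : Matrix m m A) :
    D M.det = ∑ i, (M.updateRow i fun j => D (M i j)).det := by
  have key : ∀ (s : Finset m) (f : m → A),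
      D (∏ i ∈ s, f i) = ∑ i ∈ s, ∏ l ∈ s, if l = i then D (f l) else f l := by
    intro s f
    induction s using Finset.induction_on with
    | empty => simp
    | insert a s ha ih =>
      rw [prod_insert ha, D.leibniz, ih, sum_insert ha, prod_insert ha, add_comm]
      simp only [if_true, smul_eq_mul]
      congr 1
      · rw [mul_comm]
        congr 1
        exact prod_congr rfl fun l hl => (if_neg (by rintro rfl; exact ha hl)).symm
      · rw [mul_sum]
        refine sum_congr rfl fun i hi => ?_
        rw [prod_insert ha, if_neg (by rintro rfl; exact ha hi)]
  simp only [Matrix.det_apply, map_sum]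
  rw [sum_comm]
  refine sum_congr rfl fun σ _ => ?_
  rw [← smul_sum, Units.smul_def, map_zsmul, ← Units.smul_def]
  congr 1
  rw [key]
  refine (sum_congr rfl fun i _ => prod_congr rfl fun l _ => ?_).trans
    (Equiv.sum_comp σ fun i => ∏ l, M.updateRow i (fun j => D (M i j)) (σ l) l)
  rw [Matrix.updateRow_apply]
  by_cases h : l = i
  · subst h; simp
  · rw [if_neg h, if_neg (σ.injective.ne h)]

/-- Expansion of a determinant along a row. -/
theorem det_updateRow_eq_sum (M : Matrix m m A) (i : m) (v : m → A) :
    (M.updateRow i v).det = ∑ j, v j * (M.updateRow i (Pi.single j 1)).det := by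
  rw [Matrix.det_eq_sum_mul_adjugate_row _ i]
  simp [Matrix.adjugate_apply]

variable [IsAddTorsionFree A]

/-- The Piola identity: if all rows of `M` except the row `i₀` are closed, the row of cofactors along
`i₀` is divergence-free. -/
theorem sum_derivation_cofactor_eq_zero (D : m → Derivation R A A) (M : Matrix m m A) (i₀ : m)
    (hM : ∀ i, i ≠ i₀ → ∀ j k, D j (M i k) = D k (M i j)) :
    ∑ j, D j (M.updateRow i₀ (Pi.single j 1)).det = 0 := by
  simp_rw [derivation_det]
  rw [sum_comm]
  refine sum_eq_zero fun i _ => ?_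
  by_cases hi : i = i₀
  · subst hi
    refine sum_eq_zero fun j _ => Matrix.det_eq_zero_of_row_eq_zero i fun k => ?_
    rw [Matrix.updateRow_self, Matrix.updateRow_self]
    by_cases h : k = j
    · subst h; simp
    · simp [h]
  -- Expand along the row `i`: a symmetric array is summed against an alternating one.
  set E : m → m → A := fun j k =>
    ((M.updateRow i₀ (Pi.single j 1)).updateRow i (Pi.single k 1)).det with hE
  have h1 : ∀ j, ((M.updateRow i₀ (Pi.single j 1)).updateRow i fun k =>
      D j ((M.updateRow i₀ (Pi.single j 1)) i k)).det = ∑ k, D j (M i k) * E j k := by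
    intro j
    rw [det_updateRow_eq_sum]
    exact sum_congr rfl fun k _ => by rw [Matrix.updateRow_ne hi]
  have h2 : ∀ j k, E j k = -E k j := by
    intro j k
    have hs : (M.updateRow i₀ (Pi.single k 1)).updateRow i (Pi.single j 1) =
        ((M.updateRow i₀ (Pi.single j 1)).updateRow i (Pi.single k 1)).submatrix
          (Equiv.swap i i₀) id := by
      ext a b
      simp only [Matrix.submatrix_apply, id, Matrix.updateRow_apply]
      by_cases ha : a = i
      · subst ha; simp [Ne.symm hi]
      · by_cases hb : a = i₀
        · subst hb; simp [Ne.symm hi]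
        · simp [Equiv.swap_apply_of_ne_of_ne ha hb, ha, hb]
    simp only [hE]
    rw [hs, Matrix.det_permute, Equiv.Perm.sign_swap hi]
    simp
  simp_rw [h1]
  rw [← self_eq_neg]
  conv_lhs => rw [sum_comm]
  rw [← sum_neg_distrib]
  refine sum_congr rfl fun j _ => ?_
  rw [← sum_neg_distrib]
  refine sum_congr rfl fun k _ => ?_
  rw [h2 k j, hM i hi k j, mul_neg]

/-- A determinant with one exact row and closed other rows is a sum of derivatives. -/
theorem det_updateRow_derivation (D : m → Derivation R A A) (M : Matrix m m A) (i₀ : m)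
    (hM : ∀ i, i ≠ i₀ → ∀ j k, D j (M i k) = D k (M i j)) (u : A) :
    (M.updateRow i₀ fun j => D j u).det =
      ∑ j, D j (u * (M.updateRow i₀ (Pi.single j 1)).det) := by
  rw [det_updateRow_eq_sum]
  simp only [Derivation.leibniz, sum_add_distrib, smul_eq_mul, ← mul_sum]
  rw [sum_derivation_cofactor_eq_zero D M i₀ hM, mul_zero, zero_add]
  exact sum_congr rfl fun j _ => mul_comm _ _

end Det

/-! ### Constant terms of determinants of exact rows -/

section Exact

variable {G : Type*} [AddCommGroup G] {n : ℕ} [LinearOrder (Expo G n)]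
  [IsOrderedAddMonoid (Expo G n)] {L : Type*} [Field L] [CharZero L]

instance : CharZero (HahnSeries (Expo G n) L) :=
  charZero_of_injective_algebraMap (R := L) (algebraMap L (HahnSeries (Expo G n) L)).injective

theorem coeff_theta_of_xPart_eq_zero {R : Type*} [CommRing R] (j : Fin n)
    (η : HahnSeries (Expo G n) R) {a : Expo G n} (ha : xPart a = 0) :
    (theta j η).coeff a = 0 := by
  simp [ha]

/-- Adding exact rows to a constant matrix does not change the constant term of the determinant:
by multilinearity the difference is a sum of determinants with an exact row and closed other rows,
and these are sums of Euler derivatives. -/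
theorem coeff_det_C_add_theta (c : Matrix (Fin n) (Fin n) L) (u : Fin n → HahnSeries (Expo G n) L)
    {a : Expo G n} (ha : xPart a = 0) :
    (Matrix.det (Matrix.of fun i j => C (c i j) + theta j (u i))).coeff a =
      (C c.det : HahnSeries (Expo G n) L).coeff a := by
  have key : ∀ S : Finset (Fin n), (Matrix.det (Matrix.of fun i j =>
      C (c i j) + if i ∈ S then theta j (u i) else 0)).coeff a =
        (C c.det : HahnSeries (Expo G n) L).coeff a := by
    intro S
    induction S using Finset.induction_on with
    | empty =>
      rw [RingHom.map_det]
      congr 2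
      ext1 i j
      simp
    | insert i S hi ih =>
      set M : Matrix (Fin n) (Fin n) (HahnSeries (Expo G n) L) := Matrix.of fun i j =>
        C (c i j) + if i ∈ S then theta j (u i) else 0 with hM
      have h : (Matrix.of fun l j => C (c l j) + if l ∈ insert i S then theta j (u l) else 0) =
          M.updateRow i (M i + fun j => theta j (u i)) := by
        ext1 l j
        by_cases hl : l = i
        · subst hl
          simp [hM, hi]
        · simp [hM, hl, Matrix.updateRow_ne]
      rw [h, Matrix.det_updateRow_add, Matrix.updateRow_eq_self, coeff_add, ih,
        det_updateRow_derivation (theta (R := L)) M i _ (u i), coeff_sum]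
      · rw [Finset.sum_eq_zero fun j _ => coeff_theta_of_xPart_eq_zero j _ ha, add_zero]
      · intro l _ j k
        simp only [hM, Matrix.of_apply, map_add, theta_C, zero_add]
        split_ifs
        · exact theta_comm _ _ _
        · simp
  simpa using key univ

/-- Over a field of characteristic zero `1 + ν` has a logarithm if `ν` has positive order. -/
theorem exists_theta_log (ν : HahnSeries (Expo G n) L) (hν : 0 < ν.orderTop) :
    ∃ l : HahnSeries (Expo G n) L, ∀ j, theta j ν = (1 + ν) * theta j l := by
  have hν' : 0 < (-ν).orderTop := by rwa [orderTop_neg]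
  -- `log (1 + ν) = ∑ ν (-ν) ^ m / (m + 1)`
  refine ⟨(SummableFamily.smulFamily (fun m : ℕ => ((m + 1 : ℕ) : L)⁻¹)
    (ν • SummableFamily.powers (-ν))).hsum, fun j => ?_⟩
  have h : theta j (SummableFamily.smulFamily (fun m : ℕ => ((m + 1 : ℕ) : L)⁻¹)
      (ν • SummableFamily.powers (-ν))).hsum = (theta j ν • SummableFamily.powers (-ν)).hsum := by
    ext a
    rw [theta_coeff, SummableFamily.coeff_hsum, SummableFamily.coeff_hsum, mul_finsum]
    refine finsum_congr fun m => ?_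
    -- `θ (ν (-ν) ^ m / (m + 1)) = (-ν) ^ m θ ν`
    rw [← theta_coeff]
    congr 1
    have hm : ((m + 1 : ℕ) : L) ≠ 0 := Nat.cast_ne_zero.2 m.succ_ne_zero
    have e : ν * (-ν) ^ m = -(-ν) ^ (m + 1) := by ring
    simp only [SummableFamily.smulFamily_toFun, SummableFamily.smul_apply,
      SummableFamily.powers_of_orderTop_pos hν', of_symm_smul_of_eq_mul, e]
    rw [Derivation.map_smul, Derivation.map_neg, Derivation.leibniz_pow, Derivation.map_neg,
      Nat.add_sub_cancel, ← Nat.cast_smul_eq_nsmul L, smul_eq_mul, mul_neg, smul_neg,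
      inv_smul_smul₀ hm, neg_neg, mul_comm]
  rw [h, SummableFamily.hsum_smul, mul_left_comm]
  have := SummableFamily.one_sub_self_mul_hsum_powers hν'
  rw [sub_neg_eq_add] at this
  rw [this, mul_one]

end Exact

/-! ### Constant terms of power products times the logarithmic Jacobian -/

theorem orderTop_map_pos {Γ R S F : Type*} [LinearOrder Γ] [Zero Γ] [Zero R] [Zero S]
    [FunLike F R S] [ZeroHomClass F R S]
    (φ : F) {ν : HahnSeries Γ R} (hν : 0 < ν.orderTop) : 0 < (ν.map φ).orderTop := by
  refine hν.trans_le (le_orderTop_iff_forall.2 fun a ha => ?_)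
  rw [map_coeff, coeff_eq_zero_of_lt_orderTop ha, map_zero]

section Units

variable {G : Type*} [AddCommGroup G] {n : ℕ} [LinearOrder (Expo G n)]
  [IsOrderedAddMonoid (Expo G n)]

/-- The matrix `F_i ^ k_i * (x_j ∂F_i/∂x_j) / F_i` for invertible series `F_i`; its determinant is
`F ^ k` times the logarithmic Jacobian. -/
noncomputable def logMatrix {R : Type*} [CommRing R] (U : Fin n → (HahnSeries (Expo G n) R)ˣ)
    (k : Fin n → ℤ) : Matrix (Fin n) (Fin n) (HahnSeries (Expo G n) R) :=
  Matrix.of fun i j => ↑(U i ^ k i) * (↑(U i)⁻¹ * theta j (U i : HahnSeries (Expo G n) R))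

/-- In characteristic zero every row of `logMatrix U k` is a constant row plus an exact one, so that
`coeff_det_C_add_theta` applies. -/
theorem coeff_det_logMatrix_of_charZero {L : Type*} [Field L] [CharZero L]
    (U : Fin n → (HahnSeries (Expo G n) L)ˣ) (e : Fin n → Expo G n)
    (ν : Fin n → HahnSeries (Expo G n) L) (hν : ∀ i, 0 < (ν i).orderTop)
    (hU : ∀ i, (U i : HahnSeries (Expo G n) L) = single (e i) 1 * (1 + ν i)) (k : Fin n → ℤ)
    {a : Expo G n} (ha : xPart a = 0) :
    (logMatrix U k).det.coeff a =
      (C (if k = 0 then ((xMatrix e).det : L) else 0) : HahnSeries (Expo G n) L).coeff a := by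
  choose l hl using fun i => exists_theta_log (ν i) (hν i)
  let c : Matrix (Fin n) (Fin n) L := Matrix.of fun i j =>
    if k i = 0 then (xPart (e i) j : L) else 0
  let u : Fin n → HahnSeries (Expo G n) L := fun i =>
    if k i = 0 then l i else C ((k i : L)⁻¹) * (U i : HahnSeries (Expo G n) L) ^ k i
  have hM : logMatrix U k = Matrix.of fun i j => C (c i j) + theta j (u i) := by
    ext1 i j
    simp only [logMatrix, Matrix.of_apply, c, u]
    by_cases hk : k i = 0
    · simp only [hk, if_true, zpow_zero, Units.val_one, one_mul]
      rw [Units.inv_mul_eq_iff_eq_mul, hU, Derivation.leibniz, theta_single, map_add,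
        Derivation.map_one_eq_zero, zero_add, hl, smul_eq_mul, smul_eq_mul]
      ring
    · have hk' : (k i : L) ≠ 0 := Int.cast_ne_zero.2 hk
      have hU0 : (U i : HahnSeries (Expo G n) L) ≠ 0 := (U i).ne_zero
      simp only [hk, if_false, map_zero, zero_add]
      rw [C_mul_eq_smul, Derivation.map_smul, Derivation.leibniz_zpow, Units.val_zpow_eq_zpow_val,
        Units.val_inv_eq_inv_val, ← Int.cast_smul_eq_zsmul L, inv_smul_smul₀ hk', smul_eq_mul,
        ← mul_assoc, zpow_sub_one₀ hU0]
  rw [hM, coeff_det_C_add_theta c u ha]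
  congr 2
  split_ifs with hk
  · rw [Int.cast_det]
    congr 1
    ext i j
    simp [c, hk, xMatrix]
  · obtain ⟨i, hi⟩ := Function.ne_iff.1 hk
    exact Matrix.det_eq_zero_of_row_eq_zero i fun j => if_neg hi

/-- The homomorphism of rings of Hahn series induced by a homomorphism of coefficient rings. -/
noncomputable def mapCoeff {R S : Type*} [CommRing R] [CommRing S] (φ : R →+* S) :
    HahnSeries (Expo G n) R →+* HahnSeries (Expo G n) S where
  toFun η := η.map φ
  map_one' := HahnSeries.map_one φ.toMonoidWithZeroHom
  map_mul' _ _ := HahnSeries.map_mul φ.toNonUnitalRingHom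
  map_zero' := by ext; simp
  map_add' _ _ := by ext; simp

@[simp] theorem mapCoeff_coeff {R S : Type*} [CommRing R] [CommRing S] (φ : R →+* S)
    (η : HahnSeries (Expo G n) R) (a : Expo G n) : (mapCoeff φ η).coeff a = φ (η.coeff a) := rfl

theorem coeff_det_logMatrix_map {R S : Type*} [CommRing R] [CommRing S] (φ : R →+* S)
    (U : Fin n → (HahnSeries (Expo G n) R)ˣ) (k : Fin n → ℤ) (a : Expo G n) :
    (logMatrix (fun i => Units.map (mapCoeff φ).toMonoidHom (U i)) k).det.coeff a =
      φ ((logMatrix U k).det.coeff a) := by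
  rw [← mapCoeff_coeff, RingHom.map_det]
  congr 2
  ext1 i j
  have h : ∀ η : HahnSeries (Expo G n) R, theta j (mapCoeff φ η) = mapCoeff φ (theta j η) := by
    intro η; ext; simp
  simp only [logMatrix, Matrix.of_apply, RingHom.mapMatrix_apply, Matrix.map_apply, map_mul, ← h,
    ← map_zpow, ← map_inv]
  rfl

theorem isUnit_single_mul {R : Type*} [CommRing R] (e : Expo G n) {ν : HahnSeries (Expo G n) R}
    (hν : 0 < ν.orderTop) : IsUnit (single e (1 : R) * (1 + ν)) := by
  refine IsUnit.mul ?_ (isUnit_of_orderTop_pos (by simpa using hν))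
  exact IsUnit.of_mul_eq_one (single (-e) 1) (by rw [single_mul_single]; simp)

theorem mapCoeff_single_mul {R S : Type*} [CommRing R] [CommRing S] (φ : R →+* S) (e : Expo G n)
    (ν : HahnSeries (Expo G n) R) : mapCoeff φ (single e 1 * (1 + ν)) =
      single e 1 * (1 + mapCoeff φ ν) := by
  rw [map_mul, map_add, RingHom.map_one]
  congr 1
  ext a
  by_cases h : a = e
  · rw [h, mapCoeff_coeff, coeff_single_same, coeff_single_same, RingHom.map_one]
  · simp [coeff_single_of_ne h]

/-- The constant term of `F ^ k LJ(F)` for monic `F_i`, over an arbitrary field: the identity is lifted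
to the polynomial ring `ℤ[K]`, a domain of characteristic zero that maps onto `K`. -/
theorem coeff_det_logMatrix {K : Type*} [Field K]
    (U : Fin n → (HahnSeries (Expo G n) K)ˣ) (e : Fin n → Expo G n)
    (ν : Fin n → HahnSeries (Expo G n) K) (hν : ∀ i, 0 < (ν i).orderTop)
    (hU : ∀ i, (U i : HahnSeries (Expo G n) K) = single (e i) 1 * (1 + ν i)) (k : Fin n → ℤ)
    {a : Expo G n} (ha : xPart a = 0) :
    (logMatrix U k).det.coeff a =
      (C (if k = 0 then ((xMatrix e).det : K) else 0) : HahnSeries (Expo G n) K).coeff a := by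
  classical
  let R := MvPolynomial K ℤ
  -- The lift of a constant `c ≠ 0` is the variable named `c`; zero is lifted to zero, so that
  -- supports do not grow.
  let lift : ZeroHom K R := ⟨fun c => if c = 0 then 0 else MvPolynomial.X c, if_pos rfl⟩
  let φ : R →+* K := MvPolynomial.eval₂Hom (Int.castRingHom K) id
  let ψ : R →+* FractionRing R := algebraMap R (FractionRing R)
  let ν' : Fin n → HahnSeries (Expo G n) R := fun i => (ν i).map lift
  have hν' : ∀ i, 0 < (ν' i).orderTop := fun i => orderTop_map_pos lift (hν i)
  have hφν : ∀ i, mapCoeff φ (ν' i) = ν i := by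
    intro i
    ext b
    simp only [mapCoeff_coeff, ν', map_coeff, lift, ZeroHom.coe_mk]
    split_ifs with h
    · rw [map_zero, h]
    · exact MvPolynomial.eval₂_X _ _ _
  let V : Fin n → (HahnSeries (Expo G n) R)ˣ := fun i => (isUnit_single_mul (e i) (hν' i)).unit
  have hV : (fun i => Units.map (mapCoeff φ).toMonoidHom (V i)) = U := by
    funext i
    ext1
    exact (mapCoeff_single_mul φ (e i) (ν' i)).trans (by rw [hφν, hU])
  rw [← hV, coeff_det_logMatrix_map]
  have hchar : CharZero (FractionRing R) :=
    charZero_of_injective_algebraMap (IsFractionRing.injective R (FractionRing R))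
  have hR : (logMatrix V k).det.coeff a =
      (C (if k = 0 then ((xMatrix e).det : R) else 0) : HahnSeries (Expo G n) R).coeff a := by
    apply IsFractionRing.injective R (FractionRing R)
    change ψ _ = ψ _
    rw [← coeff_det_logMatrix_map, coeff_det_logMatrix_of_charZero _ e
      (fun i => mapCoeff ψ (ν' i)) (fun i => orderTop_map_pos ψ (hν' i))
      (fun i => mapCoeff_single_mul ψ (e i) (ν' i)) k ha, ← mapCoeff_coeff]
    change _ = ((C _ : HahnSeries (Expo G n) R).map ψ).coeff a
    rw [map_C]
    split_ifs <;> simp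
  rw [hR, ← mapCoeff_coeff]
  change ((C _ : HahnSeries (Expo G n) R).map φ).coeff a = _
  rw [map_C]
  split_ifs <;> simp

end Units

/-! ### Coefficients of powers of the variables -/

section XCoeff

variable {G : Type*} [AddCommGroup G] {n : ℕ} [LinearOrder (Expo G n)]
  [IsOrderedAddMonoid (Expo G n)] {K : Type*} [Field K]

theorem xCoeff_coeff (k : Fin n → ℤ) (η : MN G n K) (g : Base G n) :
    (xCoeff k η).coeff g = η.coeff (expo g k) := rfl

theorem ofBase_coeff (c : BaseField G n K) (g : Base G n) :
    (ofBase c).coeff (expo g 0) = c.coeff g :=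
  embDomain_coeff (f := ⟨⟨baseHom, baseHom_injective⟩, Iff.rfl⟩)

theorem exists_of_ofBase_coeff_ne_zero {c : BaseField G n K} {a : Expo G n}
    (h : (ofBase c).coeff a ≠ 0) : ∃ g, a = expo g 0 ∧ c.coeff g ≠ 0 := by
  have ha : ∃ g : Base G n, expo g 0 = a := by
    by_contra hn
    refine h (embDomain_of_notMem_range (f := ⟨⟨baseHom, baseHom_injective⟩, Iff.rfl⟩) ?_)
    rintro ⟨g, rfl⟩
    exact hn ⟨g, rfl⟩
  obtain ⟨g, rfl⟩ := ha
  exact ⟨g, rfl, by rwa [ofBase_coeff] at h⟩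

/-- Taking the coefficient of `x ^ k` is linear over `K_w[G]`. -/
theorem xCoeff_ofBase_mul (k : Fin n → ℤ) (c : BaseField G n K) (η : MN G n K) :
    xCoeff k (ofBase c * η) = c * xCoeff k η := by
  ext g
  rw [xCoeff_coeff, coeff_mul, coeff_mul]
  refine Finset.sum_nbij' (fun p => (gPart p.1, gPart p.2)) (fun p => (expo p.1 0, expo p.2 k))
    ?_ ?_ ?_ ?_ ?_
  · rintro ⟨x, y⟩ h
    rw [Finset.mem_antidiagonal] at h
    obtain ⟨hx, hy, hxy⟩ := h
    obtain ⟨p, rfl, hp⟩ := exists_of_ofBase_coeff_ne_zero (mem_support _ _ |>.1 hx)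
    have hyk : xPart y = k := by simpa using congrArg xPart hxy
    refine Finset.mem_antidiagonal.2 ⟨hp, ?_, congrArg gPart hxy⟩
    rw [mem_support, xCoeff_coeff, ← hyk]
    exact hy
  · rintro ⟨p, q⟩ h
    rw [Finset.mem_antidiagonal] at h
    obtain ⟨hp, hq, hpq⟩ := h
    refine Finset.mem_antidiagonal.2 ⟨?_, hq, ?_⟩
    · rw [mem_support, ofBase_coeff]
      exact hp
    · change expo p 0 + expo q k = expo g k
      rw [← expo_add, zero_add]
      exact congrArg (expo · k) hpq
  · rintro ⟨x, y⟩ h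
    rw [Finset.mem_antidiagonal] at h
    obtain ⟨hx, hy, hxy⟩ := h
    obtain ⟨p, rfl, hp⟩ := exists_of_ofBase_coeff_ne_zero (mem_support _ _ |>.1 hx)
    have hyk : xPart y = k := by simpa using congrArg xPart hxy
    exact Prod.ext rfl (expo_ext rfl hyk.symm)
  · rintro ⟨p, q⟩ _
    rfl
  · rintro ⟨x, y⟩ h
    rw [Finset.mem_antidiagonal] at h
    obtain ⟨hx, hy, hxy⟩ := h
    obtain ⟨p, rfl, hp⟩ := exists_of_ofBase_coeff_ne_zero (mem_support _ _ |>.1 hx)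
    have hyk : xPart y = k := by simpa using congrArg xPart hxy
    rw [ofBase_coeff, gPart_expo, xCoeff_coeff, ← hyk]
    rfl

theorem xCoeff_X_mul (l : Fin n → ℤ) (i : Fin n) (η : MN G n K) :
    xCoeff l (X i * η) = xCoeff (l - Pi.single i 1) η := by
  ext g
  rw [xCoeff_coeff, xCoeff_coeff, X, coeff_single_mul, one_mul]
  congr 1
  rw [sub_eq_iff_eq_add, ← expo_add, add_zero, sub_add_cancel]

theorem xCoeff_prod_X_mul (l : Fin n → ℤ) (η : MN G n K) :
    xCoeff l ((∏ i, X i) * η) = xCoeff (l - 1) η := by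
  have key : ∀ S : Finset (Fin n), ∀ l, xCoeff l ((∏ i ∈ S, X i) * η) =
      xCoeff (l - ∑ i ∈ S, Pi.single i 1) η := by
    intro S
    induction S using Finset.induction_on with
    | empty => simp
    | insert i S hi ih =>
      intro l
      rw [prod_insert hi, mul_assoc, xCoeff_X_mul, ih, sum_insert hi, sub_sub]
  rw [key, Finset.univ_sum_single (fun _ => (1 : ℤ))]
  rfl

end XCoeff

/-! ### Initial terms -/

section Initial

variable {G : Type*} [AddCommGroup G] {n : ℕ} [LinearOrder (Expo G n)]
  [IsOrderedAddMonoid (Expo G n)] {K : Type*} [Field K]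

theorem IsXInitialTerm.coeff_eq_zero_of_lt {η : MN G n K} {c : BaseField G n K} {k : Fin n → ℤ}
    (h : IsXInitialTerm η c k) {a : Expo G n} (ha : a < expo c.order k) : η.coeff a = 0 := by
  obtain ⟨-, hck, hlt⟩ := h
  by_contra hne
  have hx : (xCoeff (xPart a) η).coeff (gPart a) ≠ 0 := hne
  have hle : (xCoeff (xPart a) η).order ≤ gPart a := order_le_of_coeff_ne_zero hx
  have hle' : expo (xCoeff (xPart a) η).order (xPart a) ≤ a := (fiber (xPart a)).le_iff_le.2 hle
  by_cases hl : xPart a = k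
  · subst hl
    rw [hck] at hle'
    exact absurd ha (not_lt.2 hle')
  · exact absurd (ha.trans (hlt _ hl fun h0 => hx (by rw [h0]; rfl))) (not_lt.2 hle')

/-- Normal form of a series with a given initial term: a nonzero constant times the initial
monomial times a series `1 + ν` with `ν` of positive order. -/
theorem IsXInitialTerm.exists_eq_mul {η : MN G n K} {c : BaseField G n K} {k : Fin n → ℤ}
    (h : IsXInitialTerm η c k) : ∃ r : K, r ≠ 0 ∧ ∃ ν : MN G n K, 0 < ν.orderTop ∧
      η = C r * (single (expo c.order k) 1 * (1 + ν)) := by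
  set e := expo c.order k with he
  have hr : η.coeff e ≠ 0 := by
    rw [he, ← xCoeff_coeff, h.2.1]
    exact coeff_order_eq_zero.not.2 h.1
  refine ⟨η.coeff e, hr, single (-e) (η.coeff e)⁻¹ * η - 1, ?_, ?_⟩
  · rw [← not_le]
    intro hle
    have hne : single (-e) (η.coeff e)⁻¹ * η - 1 ≠ 0 := by
      intro h0
      rw [h0, orderTop_zero] at hle
      exact absurd hle (by simp)
    rw [← order_eq_orderTop_of_ne_zero hne] at hle
    set o := (single (-e) (η.coeff e)⁻¹ * η - 1).order with ho
    have hle' : o ≤ 0 := by exact_mod_cast hle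
    have hco := coeff_order_eq_zero.not.2 hne
    apply hco
    rw [← ho, coeff_sub, coeff_single_mul, sub_neg_eq_add, coeff_one]
    rcases hle'.eq_or_lt with h0 | h0
    · rw [h0, zero_add, if_pos rfl, inv_mul_cancel₀ hr, sub_self]
    · have hlt : o + e < expo c.order k := add_lt_of_neg_left _ h0
      rw [if_neg h0.ne, h.coeff_eq_zero_of_lt hlt, mul_zero, sub_zero]
  · rw [add_sub_cancel, ← mul_assoc, ← mul_assoc, C_apply, single_mul_single, single_mul_single,
      zero_add, mul_one, add_neg_cancel, mul_inv_cancel₀ hr, single_zero_one, one_mul]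

end Initial

/-! ### Convergence of the composition -/

section Convergence

variable {Γ : Type*} [AddCommGroup Γ] [LinearOrder Γ] [IsOrderedAddMonoid Γ]
  {K : Type*} [Field K]

/-- The algebra of series with support in a given submonoid. -/
def supportSubalgebra (T : AddSubmonoid Γ) (K : Type*) [Field K] :
    Subalgebra K (HahnSeries Γ K) where
  carrier := {η | η.support ⊆ T}
  mul_mem' {x y} hx hy := fun a ha => by
    obtain ⟨p, hp, q, hq, rfl⟩ := Set.mem_add.1 (support_mul_subset ha)
    exact T.add_mem (hx hp) (hy hq)
  add_mem' {x y} hx hy := fun a ha => by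
    rcases support_add_subset x y ha with h | h
    · exact hx h
    · exact hy h
  algebraMap_mem' r := fun a ha => by
    rw [← C_eq_algebraMap] at ha
    rw [Set.mem_singleton_iff.1 (support_single_subset ha)]
    exact T.zero_mem

theorem one_add_zpow_mem_supportSubalgebra {T : AddSubmonoid Γ} {ν : HahnSeries Γ K}
    (hν : 0 < ν.orderTop) (hT : ν.support ⊆ T) (m : ℤ) :
    (1 + ν) ^ m ∈ supportSubalgebra T K := by
  have hmem : ν ∈ supportSubalgebra T K := hT
  have h1 : 1 + ν ∈ supportSubalgebra T K := add_mem (one_mem _) hmem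
  have hν' : 0 < (-ν).orderTop := by rwa [orderTop_neg]
  have hinv : (1 + ν)⁻¹ = (SummableFamily.powers (-ν)).hsum := by
    have := SummableFamily.one_sub_self_mul_hsum_powers hν'
    rw [sub_neg_eq_add] at this
    exact inv_eq_of_mul_eq_one_right this
  have h2 : (1 + ν)⁻¹ ∈ supportSubalgebra T K := by
    rw [hinv]
    intro a ha
    obtain ⟨m, hm⟩ := Set.mem_iUnion.1 (SummableFamily.support_hsum_subset ha)
    rw [SummableFamily.powers_of_orderTop_pos hν'] at hm
    exact pow_mem (neg_mem hmem) m hm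
  obtain ⟨m, rfl | rfl⟩ := m.eq_nat_or_neg
  · rw [zpow_natCast]
    exact pow_mem h1 m
  · rw [zpow_neg, zpow_natCast, ← inv_pow]
    exact pow_mem h2 m

variable {G : Type*} [AddCommGroup G] {n : ℕ} [LinearOrder (Expo G n)]
  [IsOrderedAddMonoid (Expo G n)]

theorem single_zpow (e : Γ) (m : ℤ) : (single e (1 : K)) ^ m = single (m • e) 1 := by
  obtain ⟨m, rfl | rfl⟩ := m.eq_nat_or_neg
  · rw [zpow_natCast, single_pow, one_pow, natCast_zsmul]
  · rw [zpow_neg, zpow_natCast, single_pow, inv_single, one_pow, inv_one, neg_smul, natCast_zsmul]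

theorem prod_single (s : Finset (Fin n)) (e : Fin n → Γ) :
    ∏ i ∈ s, single (e i) (1 : K) = single (∑ i ∈ s, e i) 1 := by
  induction s using Finset.induction_on with
  | empty => simp
  | insert i s hi ih => rw [prod_insert hi, ih, sum_insert hi, single_mul_single, one_mul]

/-- The terms `c_k F ^ k` form a summable family: the support of `c_k F ^ k` lies in the sum of the
image under `ρ` of the support of `c_k x ^ k` and the well-ordered monoid generated by the supports
of the series `ν_i`. -/
theorem exists_summableFamily {f : Fin n → Expo G n} {hf : (xMatrix f).det ≠ 0}
    (Φ : ReorderedMN f hf K) (F : Fin n → MN G n K) (r : Fin n → K) (ν : Fin n → MN G n K)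
    (hν : ∀ i, 0 < (ν i).orderTop) (hF : ∀ i, F i = C (r i) * (single (f i) 1 * (1 + ν i))) :
    ∃ s : SummableFamily (Expo G n) K (Fin n → ℤ),
      ∀ k, s k = ofBase (reorderedXCoeff k Φ) * ∏ i, F i ^ k i := by
  let T : AddSubmonoid (Expo G n) := AddSubmonoid.closure (⋃ i, (ν i).support)
  have hT : (T : Set (Expo G n)).IsPWO := by
    refine Set.IsPWO.addSubmonoid_closure ?_ ?_
    · intro a ha
      obtain ⟨i, hi⟩ := Set.mem_iUnion.1 ha
      have := (hν i).trans_le (orderTop_le_of_coeff_ne_zero hi)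
      exact le_of_lt (by exact_mod_cast this)
    · simpa using (Finset.isPWO_bUnion univ).2 fun i _ => (ν i).isPWO_support
  let S : Set (Expo G n) := (fun b => substHom f (ofReordered b)) '' Φ.support
  have hS : S.IsPWO := Φ.isPWO_support.image_of_monotone fun _ _ h => h
  have hsupp : ∀ k a, (ofBase (reorderedXCoeff k Φ) * ∏ i, F i ^ k i).coeff a ≠ 0 →
      ∃ b ∈ Φ.support, xPart (ofReordered b) = k ∧
        ∃ t ∈ T, substHom f (ofReordered b) + t = a := by
    intro k a ha
    have hprod : ∏ i, F i ^ k i = single (∑ i, k i • f i) 1 *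
        ((C (∏ i, r i ^ k i)) * ∏ i, (1 + ν i) ^ k i) := by
      rw [← prod_single, map_prod, ← prod_mul_distrib, ← prod_mul_distrib]
      refine prod_congr rfl fun i _ => ?_
      rw [hF, mul_zpow, mul_zpow, single_zpow, map_zpow₀]
      ring
    have hW : (C (∏ i, r i ^ k i)) * ∏ i, (1 + ν i) ^ k i ∈ supportSubalgebra T K := by
      refine mul_mem ?_ (prod_mem fun i _ => one_add_zpow_mem_supportSubalgebra (hν i) ?_ _)
      · rw [C_eq_algebraMap]
        exact algebraMap_mem _ _
      · exact (Set.subset_iUnion (fun i => (ν i).support) i).trans AddSubmonoid.subset_closure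
    rw [hprod, ← mul_assoc] at ha
    obtain ⟨p, hp, t, ht, rfl⟩ := Set.mem_add.1 (support_mul_subset ha)
    rw [mem_support, coeff_mul_single, mul_one] at hp
    obtain ⟨g, hg, hg'⟩ := exists_of_ofBase_coeff_ne_zero hp
    refine ⟨ofReordered.symm (expo g k), hg', rfl, t, hW ht, ?_⟩
    rw [sub_eq_iff_eq_add] at hg
    rw [hg]
    rfl
  refine ⟨⟨fun k => ofBase (reorderedXCoeff k Φ) * ∏ i, F i ^ k i, ?_, ?_⟩, fun k => rfl⟩
  · refine (hS.add hT).mono (Set.iUnion_subset fun k a ha => ?_)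
    obtain ⟨b, hb, -, t, ht, rfl⟩ := hsupp k a ha
    exact Set.add_mem_add ⟨b, hb, rfl⟩ ht
  · intro a
    refine ((Finset.antidiagonal hS hT a).finite_toSet.image
      fun p => xPart (Function.invFun (substHom f) p.1)).subset fun k hk => ?_
    obtain ⟨b, hb, hbk, t, ht, rfl⟩ := hsupp k a hk
    refine ⟨(substHom f (ofReordered b), t), ?_, ?_⟩
    · exact Finset.mem_coe.2 (Finset.mem_antidiagonal.2 ⟨⟨b, hb, rfl⟩, ht, rfl⟩)
    · change xPart (Function.invFun (substHom f) (substHom f (ofReordered b))) = k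
      rw [Function.leftInverse_invFun (substHom_injective f hf), hbk]

end Convergence

/-! ### The residue formula -/

section Residue

variable {G : Type*} [AddCommGroup G] {n : ℕ} [LinearOrder (Expo G n)]
  [IsOrderedAddMonoid (Expo G n)] {K : Type*} [Field K]

theorem X_mul_pderiv (i : Fin n) (η : MN G n K) : X i * pderiv i η = theta i η := by
  rw [pderiv, ← mul_assoc, X, single_mul_single, ← expo_add, add_zero, add_neg_cancel, one_mul]
  exact one_mul _

theorem prod_X_mul_jacobian (F : Fin n → MN G n K) :
    (∏ i, X i) * jacobian F = Matrix.det (Matrix.of fun i j => theta j (F i)) := by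
  rw [jacobian, ← Matrix.det_mul_row]
  simp only [Matrix.of_apply, X_mul_pderiv]

theorem prod_zpow_mul_logJacobian (F : Fin n → MN G n K) (k : Fin n → ℤ) :
    (∏ i, F i ^ k i) * logJacobian F =
      Matrix.det (Matrix.of fun i j => F i ^ k i * ((F i)⁻¹ * theta j (F i))) := by
  have h := Matrix.det_mul_column (fun i => F i ^ k i * (F i)⁻¹)
    (Matrix.of fun i j => theta j (F i))
  rw [← prod_X_mul_jacobian, prod_mul_distrib] at h
  simp only [Matrix.of_apply, mul_assoc] at h
  rw [h, logJacobian, div_eq_mul_inv, prod_inv_distrib]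
  ring

/-- The second identity of the theorem for a monomial `Φ = x ^ k`. -/
theorem CT_prod_zpow_mul_logJacobian (F : Fin n → MN G n K) (e : Fin n → Expo G n)
    (r : Fin n → K) (hr : ∀ i, r i ≠ 0) (ν : Fin n → MN G n K) (hν : ∀ i, 0 < (ν i).orderTop)
    (hF : ∀ i, F i = C (r i) * (single (e i) 1 * (1 + ν i))) (k : Fin n → ℤ) :
    CT ((∏ i, F i ^ k i) * logJacobian F) =
      if k = 0 then (((xMatrix e).det : ℤ) : BaseField G n K) else 0 := by
  let U : Fin n → (MN G n K)ˣ := fun i => (isUnit_single_mul (e i) (hν i)).unit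
  have hFU : ∀ i, F i = C (r i) * (U i : MN G n K) := hF
  have hdet : Matrix.det (Matrix.of fun i j => F i ^ k i * ((F i)⁻¹ * theta j (F i))) =
      C (∏ i, r i ^ k i) * (logMatrix U k).det := by
    rw [map_prod, ← Matrix.det_mul_column]
    congr 1
    ext1 i j
    simp only [Matrix.of_apply, logMatrix]
    have hC : (C (r i) : MN G n K) ≠ 0 := C_ne_zero (hr i)
    rw [hFU, Derivation.leibniz, theta_C, smul_zero, add_zero, smul_eq_mul, mul_inv, mul_zpow,
      Units.val_zpow_eq_zpow_val, Units.val_inv_eq_inv_val, map_zpow₀]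
    field_simp
  rw [prod_zpow_mul_logJacobian, hdet]
  ext g
  rw [CT, xCoeff_coeff, C_mul_eq_smul, coeff_smul,
    coeff_det_logMatrix U e ν hν (fun i => rfl) k (xPart_expo g 0)]
  have h0 : expo g (0 : Fin n → ℤ) = 0 ↔ g = 0 := baseHom_injective.eq_iff' rfl
  split_ifs with hk
  · subst hk
    rw [← single_zero_intCast]
    by_cases hg : g = 0
    · subst hg
      rw [h0.2 rfl, C_apply]
      simp
    · rw [C_apply, coeff_single_of_ne (mt h0.1 hg), coeff_single_of_ne hg, smul_zero]
  · simp

/-- The coefficient of `x ^ l` in `Φ(F) J`, when only the term with `k = k₀` contributes to it. -/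
theorem xCoeff_hsum_mul {f : Fin n → Expo G n} {hf : (xMatrix f).det ≠ 0}
    (Φ : ReorderedMN f hf K) (F : Fin n → MN G n K) (s : SummableFamily (Expo G n) K (Fin n → ℤ))
    (hs : ∀ k, s k = ofBase (reorderedXCoeff k Φ) * ∏ i, F i ^ k i) (J : MN G n K)
    (l k₀ : Fin n → ℤ) (d : BaseField G n K)
    (hJ : ∀ k, xCoeff l ((∏ i, F i ^ k i) * J) = if k = k₀ then d else 0) :
    xCoeff l (s.hsum * J) = d * reorderedXCoeff k₀ Φ := by
  have h : ∀ k, xCoeff l (J * s k) = if k = k₀ then d * reorderedXCoeff k₀ Φ else 0 := by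
    intro k
    rw [hs, mul_comm, mul_assoc, xCoeff_ofBase_mul, hJ]
    split_ifs with hk
    · rw [hk, mul_comm]
    · rw [mul_zero]
  ext g
  rw [xCoeff_coeff, mul_comm, ← SummableFamily.hsum_smul, SummableFamily.coeff_hsum]
  rw [finsum_eq_single _ k₀]
  · exact congrArg (fun η : BaseField G n K => η.coeff g) ((h k₀).trans (if_pos rfl))
  · intro k hk
    exact congrArg (fun η : BaseField G n K => η.coeff g) ((h k).trans (if_neg hk))

end Residue

end MNSeries

theorem theorem3 {G : Type*} [AddCommGroup G] {n : ℕ}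
    [LinearOrder (MNSeries.Expo G n)] [IsOrderedAddMonoid (MNSeries.Expo G n)]
    {K : Type*} [Field K]
    (F : Fin n → MNSeries.MN G n K)
    (a : Fin n → MNSeries.BaseField G n K) (b : Matrix (Fin n) (Fin n) ℤ)
    (hF : ∀ i, MNSeries.IsXInitialTerm (F i) (a i) (b i))
    (hj : b.det ≠ 0)
    (Φ : MNSeries.ReorderedMN (MNSeries.initialExpo a b) hj K) :
    ∃ Ψ : MNSeries.MN G n K, MNSeries.IsComposition Φ F Ψ ∧
      MNSeries.Res (Ψ * MNSeries.jacobian F) =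
        (b.det : MNSeries.BaseField G n K) * MNSeries.reorderedRes Φ ∧
      MNSeries.CT (Ψ * MNSeries.logJacobian F) =
        (b.det : MNSeries.BaseField G n K) * MNSeries.reorderedCT Φ := by
  choose r hr ν hν hFν using fun i => (hF i).exists_eq_mul
  obtain ⟨s, hs⟩ := MNSeries.exists_summableFamily Φ F r ν hν hFν
  have hCT := MNSeries.CT_prod_zpow_mul_logJacobian F (MNSeries.initialExpo a b) r hr ν hν hFν
  have hF0 : ∀ i, F i ≠ 0 := fun i h0 =>
    (hF i).1 ((hF i).2.1.symm.trans (by rw [h0]; rfl))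
  refine ⟨s.hsum, fun g => ⟨?_, ?_⟩, ?_, ?_⟩
  · exact (s.finite_co_support g).subset fun k hk => by
      rw [Function.mem_support, hs]
      exact hk
  · rw [HahnSeries.SummableFamily.coeff_hsum]
    exact finsum_congr fun k => by rw [hs]
  · refine MNSeries.xCoeff_hsum_mul Φ F s hs _ _ _ _ fun k => ?_
    -- `F ^ k * J(F) = (x₁ ⋯ xₙ)⁻¹ * F ^ (k + 1) * LJ(F)`
    have h : (∏ i, MNSeries.X i) * ((∏ i, F i ^ k i) * MNSeries.jacobian F) =
        (∏ i, F i ^ (k + 1) i) * MNSeries.logJacobian F := by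
      have hP : ∏ i, F i ≠ 0 := Finset.prod_ne_zero_iff.2 fun i _ => hF0 i
      simp only [Pi.add_apply, Pi.one_apply, zpow_add_one₀ (hF0 _), Finset.prod_mul_distrib,
        MNSeries.logJacobian]
      field_simp
    have h' := MNSeries.xCoeff_prod_X_mul 0 ((∏ i, F i ^ k i) * MNSeries.jacobian F)
    rw [zero_sub, h] at h'
    refine (h'.symm.trans (hCT (k + 1))).trans (if_congr ?_ rfl rfl)
    exact add_eq_zero_iff_eq_neg
  · exact MNSeries.xCoeff_hsum_mul Φ F s hs _ _ _ _ hCT
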